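/- All morphisms are *-homomorphisms of (not necessarily unital) complex C*-algebras. Put $\mathbb I=[0,1]$, $\mathbb I_0^k=(0,1)^k$, and identify $S^{k-1}$ with the boundary $\mathbb I^k\setminus\mathbb I_0^k$ of the cube. **NCCW complexes.** A noncommutative CW (NCCW) complex of dimension $0$ is a finite-dimensional C*-algebra $A_0$. An NCCW complex of dimension $n\ge 1$ is a C*-algebra $A=A_n$ together with a sequence $A_0,A_1,\dots,A_n$ in which $A_0$ is finite-dimensional and, for $1\le k\le n$, $A_k$ is identified with a pullback $$A_k\cong\{f\oplus a\in C(\mathbb I^k,F_k)\oplus A_{k-1}\;:\; f|_{S^{k-1}}=\sigma_k(a)\}$$ for some finite-dimensional C*-algebra $F_k$ and some morphism $\sigma_k:A_{k-1}\to C(S^{k-1},F_k)$. Put $F_0=A_0$. The canonical ideals are $I_0=A$, $I_k=\ker(A_n\to A_{k-1})$ for $1\le k\le n$, and $I_k=0$ for $k>n$; thus $I_k/I_{k+1}\cong C_0(\mathbb I_0^k,F_k)$ for $0\le k\le n$. The finite-dimensional algebras here may be zero; the dimension $n$ is called exact if $I_n\neq 0$. **Simplicial morphisms.** Let $A$ and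 $B$ be NCCW complexes of dimensions $n$ and $m$, with canonical ideals $I_k$, $J_k$ and finite-dimensional algebras $F_k$, $G_k$. A morphism $\alpha:A\to B$ is simplicial if $\alpha(I_k)\subseteq J_k$ for all $k$ (in particular $\alpha(I_k)=0$ for $k>m$) and, for each $0\le k\le \min\{n,m\}$, the induced morphism $\tilde\alpha_k:C_0(\mathbb I_0^k,F_k)\to C_0(\mathbb I_0^k,G_k)$ is of the form $\tilde\alpha_k(f)=\varphi_k\circ f\circ i_k$ for some morphism $\varphi_k:F_k\to G_k$ and some homeomorphism $i_k$ of $\mathbb I^k$. **Proposition.** Let $\alpha:A\to B$ be a simplicial morphism between NCCW complexes of dimensions $n$ and $m$. Then the NC mapping cone $$\mathrm{Cone}(\alpha)=\{a\oplus f\in A\oplus C(\mathbb I,B)\;:\; f(0)=0,\ f(1)=\alpha(a)\}$$ is an NCCW complex of dimension $\max\{n,m+1\}$; that is, it carries such a structure. Moreover, this structure can be chosen so that its dimension is exact whenever the dimensions of $A$ and $B$ are exact. -/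

import Mathlib

open scoped Topology CStarAlgebra

universe u

noncomputable section

namespace NCCW

/-- The pullback `A₁ ⊕_C A₂ = {a₁ ⊕ a₂ | α₁ a₁ = α₂ a₂}`, as a *-subalgebra of `A₁ ⊕ A₂`. -/
def Pullback {A₁ A₂ C : Type*} [NonUnitalCStarAlgebra A₁] [NonUnitalCStarAlgebra A₂]
    [NonUnitalCStarAlgebra C] (α₁ : A₁ →⋆ₙₐ[ℂ] C) (α₂ : A₂ →⋆ₙₐ[ℂ] C) :
    NonUnitalStarSubalgebra ℂ (A₁ × A₂) :=
  NonUnitalStarAlgHom.equalizer (α₁.comp (NonUnitalStarAlgHom.fst ℂ A₁ A₂))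
    (α₂.comp (NonUnitalStarAlgHom.snd ℂ A₁ A₂))

theorem mem_pullback {A₁ A₂ C : Type*} [NonUnitalCStarAlgebra A₁] [NonUnitalCStarAlgebra A₂]
    [NonUnitalCStarAlgebra C] (α₁ : A₁ →⋆ₙₐ[ℂ] C) (α₂ : A₂ →⋆ₙₐ[ℂ] C) (x : A₁ × A₂) :
    x ∈ Pullback α₁ α₂ ↔ α₁ x.1 = α₂ x.2 :=
  Iff.rfl

/-- A pullback is norm closed. -/
theorem isClosed_pullback {A₁ A₂ C : Type*} [NonUnitalCStarAlgebra A₁]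
    [NonUnitalCStarAlgebra A₂] [NonUnitalCStarAlgebra C]
    (α₁ : A₁ →⋆ₙₐ[ℂ] C) (α₂ : A₂ →⋆ₙₐ[ℂ] C) :
    IsClosed (Pullback α₁ α₂ : Set (A₁ × A₂)) :=
  isClosed_eq ((map_continuous α₁).comp continuous_fst) ((map_continuous α₂).comp continuous_snd)

/-- A pullback of C*-algebras is a C*-algebra. -/
instance {A₁ A₂ C : Type*} [NonUnitalCStarAlgebra A₁] [NonUnitalCStarAlgebra A₂]
    [NonUnitalCStarAlgebra C] (α₁ : A₁ →⋆ₙₐ[ℂ] C) (α₂ : A₂ →⋆ₙₐ[ℂ] C) :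
    NonUnitalCStarAlgebra (Pullback α₁ α₂) :=
  NonUnitalStarSubalgebra.nonUnitalCStarAlgebra _ (h_closed := isClosed_pullback α₁ α₂)

/-- Evaluation at a point, as a *-homomorphism `C(X, A) → A`. -/
def ev {X : Type*} [TopologicalSpace X] (A : Type*) [NonUnitalCStarAlgebra A] (x : X) :
    C(X, A) →⋆ₙₐ[ℂ] A where
  toFun f := f x
  map_smul' _ _ := rfl
  map_zero' := rfl
  map_add' _ _ := rfl
  map_mul' _ _ := rfl
  map_star' _ := rfl

/-- Constant functions, as a *-homomorphism `A → C(X, A)`. -/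
def constHom (X : Type*) [TopologicalSpace X] (A : Type*) [NonUnitalCStarAlgebra A] :
    A →⋆ₙₐ[ℂ] C(X, A) where
  toFun a := ContinuousMap.const X a
  map_smul' _ _ := rfl
  map_zero' := rfl
  map_add' _ _ := rfl
  map_mul' _ _ := rfl
  map_star' _ := rfl

/-- The cone `CA = {f ∈ C([0,1], A) | f 0 = 0}`. -/
def ConeAlg (A : Type*) [NonUnitalCStarAlgebra A] :
    NonUnitalStarSubalgebra ℂ C(unitInterval, A) :=
  NonUnitalStarAlgHom.equalizer (ev A (0 : unitInterval)) 0

theorem mem_coneAlg {A : Type*} [NonUnitalCStarAlgebra A] (f : C(unitInterval, A)) :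
    f ∈ ConeAlg A ↔ f 0 = 0 :=
  Iff.rfl

theorem isClosed_coneAlg (A : Type*) [NonUnitalCStarAlgebra A] :
    IsClosed (ConeAlg A : Set C(unitInterval, A)) :=
  isClosed_eq (map_continuous (ev A (0 : unitInterval))) continuous_const

instance (A : Type*) [NonUnitalCStarAlgebra A] : NonUnitalCStarAlgebra (ConeAlg A) :=
  NonUnitalStarSubalgebra.nonUnitalCStarAlgebra _ (h_closed := isClosed_coneAlg A)

/-- The mapping cone `Cone(α) = {a ⊕ f ∈ A ⊕ CB | α a = f 1}`; it is a C*-algebra, being the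
pullback of `α` and of the evaluation at `1`. -/
abbrev MappingCone {A B : Type*} [NonUnitalCStarAlgebra A] [NonUnitalCStarAlgebra B]
    (α : A →⋆ₙₐ[ℂ] B) : NonUnitalStarSubalgebra ℂ (A × ConeAlg B) :=
  Pullback α ((ev B (1 : unitInterval)).comp (NonUnitalStarSubalgebraClass.subtype (ConeAlg B)))

theorem mem_mappingCone {A B : Type*} [NonUnitalCStarAlgebra A] [NonUnitalCStarAlgebra B]
    (α : A →⋆ₙₐ[ℂ] B) (x : A × ConeAlg B) :
    x ∈ MappingCone α ↔ α x.1 = (x.2 : C(unitInterval, B)) 1 :=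
  Iff.rfl

/-- The cube `[0,1]^k`. -/
abbrev UnitCube (k : ℕ) : Type := Fin k → unitInterval

/-- The boundary `[0,1]^k \ (0,1)^k` of the cube, identified with the sphere `S^{k-1}`. -/
abbrev Bdry (k : ℕ) : Type := Cube.boundary (Fin k)

theorem isClosed_boundary (k : ℕ) : IsClosed (Cube.boundary (Fin k)) := by
  have : Cube.boundary (Fin k) = ⋃ i : Fin k, {y : UnitCube k | y i = 0 ∨ y i = 1} := by
    ext y; simp [Cube.boundary]
  rw [this]
  exact isClosed_iUnion_of_finite fun i =>
    (isClosed_eq (continuous_apply i) continuous_const).union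
      (isClosed_eq (continuous_apply i) continuous_const)

instance (k : ℕ) : CompactSpace (Bdry k) :=
  isCompact_iff_compactSpace.mp (isClosed_boundary k).isCompact

/-- The restriction morphism `∂ : C([0,1]^k, F) → C(S^{k-1}, F)`. -/
def restr (k : ℕ) (F : Type*) [NonUnitalCStarAlgebra F] :
    C(UnitCube k, F) →⋆ₙₐ[ℂ] C(Bdry k, F) where
  toFun f := f.restrict (Cube.boundary (Fin k))
  map_smul' _ _ := rfl
  map_zero' := rfl
  map_add' _ _ := rfl
  map_mul' _ _ := rfl
  map_star' _ := rfl

/-- `NCCWComplex n A` is the type of structures of NCCW complex of dimension `n` on the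
C*-algebra `A`: for `n = 0`, `A` is finite-dimensional; a structure in dimension `n + 1` consists
of a structure in dimension `n` on some C*-algebra `A'`, a finite-dimensional C*-algebra `F`,
a connecting morphism `θ : A' → C(S^n, F)`, and an identification `e` of `A` with the pullback
of the restriction morphism `∂ : C([0,1]^{n+1}, F) → C(S^n, F)` and `θ`. -/
inductive NCCWComplex : (n : ℕ) → (A : Type u) → [NonUnitalCStarAlgebra A] → Type (u + 1)
  | zero (A : Type u) [NonUnitalCStarAlgebra A] [FiniteDimensional ℂ A] : NCCWComplex 0 A
  | succ {n : ℕ} {A' : Type u} [NonUnitalCStarAlgebra A'] (X : NCCWComplex n A')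
      (F : Type u) [NonUnitalCStarAlgebra F] [FiniteDimensional ℂ F]
      (θ : A' →⋆ₙₐ[ℂ] C(Bdry (n + 1), F))
      (A : Type u) [NonUnitalCStarAlgebra A]
      (e : A ≃⋆ₐ[ℂ] Pullback (restr (n + 1) F) θ) : NCCWComplex (n + 1) A

section projections

variable {k : ℕ} {A A' F : Type*} [NonUnitalCStarAlgebra A] [NonUnitalCStarAlgebra A']
  [NonUnitalCStarAlgebra F] {θ : A' →⋆ₙₐ[ℂ] C(Bdry k, F)}

/-- The projection `ρ : A → C([0,1]^k, F)` of the pullback decomposition. -/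
def rhoMap (e : A ≃⋆ₐ[ℂ] Pullback (restr k F) θ) : A →⋆ₙₐ[ℂ] C(UnitCube k, F) :=
  (NonUnitalStarAlgHom.fst ℂ _ _).comp
    ((NonUnitalStarSubalgebraClass.subtype (Pullback (restr k F) θ)).comp
      (e : A →⋆ₙₐ[ℂ] Pullback (restr k F) θ))

/-- The projection `π : A → A'` of the pullback decomposition. -/
def piMap (e : A ≃⋆ₐ[ℂ] Pullback (restr k F) θ) : A →⋆ₙₐ[ℂ] A' :=
  (NonUnitalStarAlgHom.snd ℂ _ _).comp
    ((NonUnitalStarSubalgebraClass.subtype (Pullback (restr k F) θ)).comp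
      (e : A →⋆ₙₐ[ℂ] Pullback (restr k F) θ))

end projections

/-- A C*-algebra `F` together with a *-homomorphism `ρ : A → C([0,1]^k, F)`. -/
structure Cell (A : Type u) [NonUnitalCStarAlgebra A] (k : ℕ) where
  F : Type u
  [cstar : NonUnitalCStarAlgebra F]
  ρ : A →⋆ₙₐ[ℂ] C(UnitCube k, F)

attribute [instance] Cell.cstar

namespace NCCWComplex

/-- The canonical ideals `A = I₀ ⊇ I₁ ⊇ … ⊇ Iₙ` of an `n`-dimensional NCCW complex: `I_k` is the
kernel of the composite projection `A = Aₙ → A_{k-1}` if `1 ≤ k ≤ n`; also `I_k = 0` for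
`k > n`. -/
def canonicalIdeal {n : ℕ} {A : Type u} [NonUnitalCStarAlgebra A] :
    NCCWComplex n A → ℕ → TwoSidedIdeal A
  | zero _, k => if k = 0 then ⊤ else ⊥
  | succ (n := n) X _ _ _ e, k =>
      if k ≤ n + 1 then TwoSidedIdeal.comap (piMap e) (X.canonicalIdeal k) else ⊥

/-- The `k`-th cell of an NCCW complex: the finite-dimensional C*-algebra `F_k`, with the
composite of the projection `A = Aₙ → A_k` and of `ρ_k : A_k → C([0,1]^k, F_k)`. For `k = 0`,
`F₀ = A₀` and `ρ₀` is the identification of `A₀` with `C([0,1]^0, A₀)`. On the canonical ideal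
`I_k`, `ρ` takes values in `C₀((0,1)^k, F_k)` and induces the identification of `I_k / I_{k+1}`
with `C₀((0,1)^k, F_k)`. -/
def cell {n : ℕ} {A : Type u} [NonUnitalCStarAlgebra A] :
    NCCWComplex n A → (k : ℕ) → k ≤ n → Cell A k
  | zero A, _, _ => { F := A, ρ := constHom _ A }
  | succ (n := n) X F _ _ e, k, hk =>
      if h : k ≤ n then
        { F := (X.cell k h).F, ρ := (X.cell k h).ρ.comp (piMap e) }
      else
        (show n + 1 = k by omega) ▸ { F := F, ρ := rhoMap e }

/-- A morphism `α : A → B` between NCCW complexes is simplicial if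
(i) `α(I_k) ⊆ J_k` for all `k`, and
(ii) for every `k` the morphism `C₀((0,1)^k, F_k) → C₀((0,1)^k, G_k)` that `α` induces on
`I_k / I_{k+1} → J_k / J_{k+1}` is of the form `i_k^* ⊗ φ_k`, that is `f ↦ φ_k ∘ f ∘ i_k`,
for a morphism `φ_k : F_k → G_k` and a homeomorphism `i_k` of `[0,1]^k`.
(For `m < k ≤ n` condition (ii) is void, since `J_k = 0`.) -/
structure IsSimplicial {n m : ℕ} {A B : Type u} [NonUnitalCStarAlgebra A]
    [NonUnitalCStarAlgebra B] (X : NCCWComplex n A) (Y : NCCWComplex m B)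
    (α : A →⋆ₙₐ[ℂ] B) : Prop where
  map_ideal : ∀ k : ℕ, ∀ a ∈ X.canonicalIdeal k, α a ∈ Y.canonicalIdeal k
  map_cell : ∀ (k : ℕ) (hn : k ≤ n) (hm : k ≤ m),
    ∃ (φ : (X.cell k hn).F →⋆ₙₐ[ℂ] (Y.cell k hm).F) (i : UnitCube k ≃ₜ UnitCube k),
      ∀ a ∈ X.canonicalIdeal k, ∀ s : UnitCube k, s ∉ Cube.boundary (Fin k) →
        (Y.cell k hm).ρ (α a) s = φ ((X.cell k hn).ρ a (i s))

end NCCWComplex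

end NCCW

end

noncomputable section

namespace NCCW

/-! Attaching zero cells makes `A` of dimension N+1 and `B` of dimension N, where N+1 = max n (m+1).
Since α sends `I_{N+1}` into `J_{N+1} = 0`, it factors through `A_N`; composing with `B → B_{N-1}`
gives `α' : A_N → B_{N-1}`, which again respects the canonical ideals. The map `Cone(α) → Cone(α')`
is onto, and its kernel consists of independent pairs from the top ideal of `A` and from paths in
the top ideal of `B` vanishing at both ends. It is therefore C₀((0,1)^{N+1}, F_{N+1} × G_N): the
cylinder over an N-cell of `B` is an (N+1)-cell (`exists_mappingCone_equiv`). So `Cone(α)` arises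
from `Cone(α')` by attaching one layer of cells, and induction on N finishes (`exists_mappingCone`).
The new top ideal is nonzero as soon as one of the two old ones is. -/

/-- The zero C*-algebra. -/
instance : NonUnitalCStarAlgebra PUnit.{u + 1} where
  star x := x
  star_involutive _ := rfl
  star_mul _ _ := rfl
  star_add _ _ := rfl
  star_smul _ _ := rfl
  norm_mul_self_le := by simp

/-- A *-homomorphism that vanishes on the kernel of a surjective one factors through it. -/
theorem exists_factor {A B C : Type*} [NonUnitalCStarAlgebra A] [NonUnitalCStarAlgebra B]
    [NonUnitalCStarAlgebra C] (p : A →⋆ₙₐ[ℂ] B) (f : A →⋆ₙₐ[ℂ] C)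
    (hp : Function.Surjective p) (h : ∀ x, p x = 0 → f x = 0) :
    ∃ g : B →⋆ₙₐ[ℂ] C, ∀ x, g (p x) = f x := by
  have key : ∀ x y, p x = p y → f x = f y := fun x y hxy => by
    have := h (x - y) (by rw [map_sub, hxy, sub_self])
    rwa [map_sub, sub_eq_zero] at this
  choose s hs using hp
  exact ⟨{ toFun := fun b => f (s b)
           map_smul' := fun c b => by
             rw [MonoidHom.id_apply, ← map_smul]; exact key _ _ (by simp [hs])
           map_zero' := by rw [← map_zero f]; exact key _ _ (by simp [hs])
           map_add' := fun a b => by rw [← map_add]; exact key _ _ (by simp [hs])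
           map_mul' := fun a b => by rw [← map_mul]; exact key _ _ (by simp [hs])
           map_star' := fun a => by rw [← map_star]; exact key _ _ (by rw [map_star, hs, hs]) },
    fun x => key _ _ (hs _)⟩

/-! ### Pullback decompositions: lifting and recognition -/

section projections

variable {k : ℕ} {A A' F : Type*} [NonUnitalCStarAlgebra A] [NonUnitalCStarAlgebra A']
  [NonUnitalCStarAlgebra F] {θ : A' →⋆ₙₐ[ℂ] C(Bdry k, F)}

theorem rhoMap_of_mem_boundary (e : A ≃⋆ₐ[ℂ] Pullback (restr k F) θ) (a : A) {y : UnitCube k}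
    (hy : y ∈ Cube.boundary (Fin k)) : rhoMap e a y = θ (piMap e a) ⟨y, hy⟩ :=
  DFunLike.congr_fun (show restr k F (rhoMap e a) = θ (piMap e a) from (e a).2) ⟨y, hy⟩

theorem eq_of_rhoMap_eq_of_piMap_eq (e : A ≃⋆ₐ[ℂ] Pullback (restr k F) θ) {a b : A}
    (hρ : rhoMap e a = rhoMap e b) (hπ : piMap e a = piMap e b) : a = b :=
  e.injective (Subtype.ext (Prod.ext hρ hπ))

theorem rhoMap_symm (e : A ≃⋆ₐ[ℂ] Pullback (restr k F) θ) (z : Pullback (restr k F) θ) :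
    rhoMap e (e.symm z) = z.1.1 :=
  congrArg (fun w : Pullback (restr k F) θ => w.1.1) (e.apply_symm_apply z)

theorem piMap_symm (e : A ≃⋆ₐ[ℂ] Pullback (restr k F) θ) (z : Pullback (restr k F) θ) :
    piMap e (e.symm z) = z.1.2 :=
  congrArg (fun w : Pullback (restr k F) θ => w.1.2) (e.apply_symm_apply z)

/-- Every continuous family in `A'` lifts along the projection `A → A'`. -/
theorem exists_continuousMap_lift [FiniteDimensional ℂ F] (e : A ≃⋆ₐ[ℂ] Pullback (restr k F) θ)
    {X : Type} [TopologicalSpace X] [CompactSpace X] [T2Space X] (f : C(X, A')) :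
    ∃ g : C(X, A), ∀ x, piMap e (g x) = f x := by
  -- The lift of `f` needs a cube component with boundary values `θ ∘ f`: these form a function on
  -- the closed set X × ∂I^k, extended by Tietze since `F` is finite-dimensional.
  let h : C(X × Bdry k, F) := ((⟨θ, map_continuous θ⟩ : C(A', C(Bdry k, F))).comp f).uncurry
  have hcl : Topology.IsClosedEmbedding (Prod.map id Subtype.val : X × Bdry k → X × UnitCube k) :=
    Topology.IsClosedEmbedding.id.prodMap (isClosed_boundary k).isClosedEmbedding_subtypeVal
  obtain ⟨H, hH⟩ := h.exists_extension' hcl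
  let z : X → Pullback (restr k F) θ := fun x => ⟨(H.curry x, f x), by
    rw [mem_pullback]
    ext b
    exact congrFun hH (x, b)⟩
  have hz : Continuous z := (H.curry.continuous.prodMk f.continuous).subtype_mk _
  have he : Continuous e.symm := map_continuous e.symm
  exact ⟨⟨fun x => e.symm (z x), he.comp hz⟩, fun x => piMap_symm e (z x)⟩

theorem piMap_surjective [FiniteDimensional ℂ F] (e : A ≃⋆ₐ[ℂ] Pullback (restr k F) θ) :
    Function.Surjective (piMap e) := fun a => by
  obtain ⟨g, hg⟩ := exists_continuousMap_lift e (ContinuousMap.const Unit a)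
  exact ⟨g (), hg ()⟩

end projections

/-- A criterion for `C` to be a pullback of the restriction morphism and a morphism on `C'`. -/
theorem exists_pullback_equiv {k : ℕ} {C C' E : Type*} [NonUnitalCStarAlgebra C]
    [NonUnitalCStarAlgebra C'] [NonUnitalCStarAlgebra E] (p : C →⋆ₙₐ[ℂ] C')
    (r : C →⋆ₙₐ[ℂ] C(UnitCube k, E)) (hp : Function.Surjective p)
    (hr : ∀ x, p x = 0 → ∀ y ∈ Cube.boundary (Fin k), r x y = 0)
    (hinj : ∀ x, p x = 0 → r x = 0 → x = 0)
    (hsurj : ∀ g : C(UnitCube k, E), (∀ y ∈ Cube.boundary (Fin k), g y = 0) →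
      ∃ x, p x = 0 ∧ r x = g) :
    ∃ (θ : C' →⋆ₙₐ[ℂ] C(Bdry k, E)) (e : C ≃⋆ₐ[ℂ] Pullback (restr k E) θ), piMap e = p := by
  -- By `hr`, the boundary values of `r x` depend only on `p x`; this dependence is the connecting
  -- morphism.
  obtain ⟨θ, hθ⟩ := exists_factor p ((restr k E).comp r) hp
    fun x hx => ContinuousMap.ext fun y => hr x hx y y.2
  let f : C →⋆ₙₐ[ℂ] Pullback (restr k E) θ :=
    NonUnitalStarAlgHom.codRestrict (r.prod p) _ fun x => (hθ x).symm
  have hf : Function.Bijective f := by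
    refine ⟨(injective_iff_map_eq_zero f).2 fun x hx => ?_, fun z => ?_⟩
    · have h : (r x, p x) = 0 := congrArg Subtype.val hx
      exact hinj x (congrArg Prod.snd h) (congrArg Prod.fst h)
    · obtain ⟨x, hx⟩ := hp z.1.2
      obtain ⟨w, hw, hw'⟩ := hsurj (z.1.1 - r x) fun y hy => by
        have h1 : restr k E z.1.1 = θ (p x) := by rw [hx]; exact z.2
        rw [hθ] at h1
        exact sub_eq_zero.2 (DFunLike.congr_fun h1 ⟨y, hy⟩)
      refine ⟨x + w, Subtype.ext (Prod.ext ?_ ?_)⟩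
      · change r (x + w) = z.1.1
        rw [map_add, hw', add_sub_cancel]
      · change p (x + w) = z.1.2
        rw [map_add, hw, add_zero, hx]
  exact ⟨θ, StarAlgEquiv.ofBijective f hf, rfl⟩

/-! ### Mapping cones of morphisms between pullbacks -/

/-- Postcomposition with a *-homomorphism that respects the attaching maps, between
mapping cones. -/
def mappingConeMap {A A' B B' : Type*} [NonUnitalCStarAlgebra A] [NonUnitalCStarAlgebra A']
    [NonUnitalCStarAlgebra B] [NonUnitalCStarAlgebra B'] {α : A →⋆ₙₐ[ℂ] B} {α' : A' →⋆ₙₐ[ℂ] B'}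
    (p : A →⋆ₙₐ[ℂ] A') (q : B →⋆ₙₐ[ℂ] B') (h : ∀ a, q (α a) = α' (p a)) :
    MappingCone α →⋆ₙₐ[ℂ] MappingCone α' where
  toFun x := ⟨(p x.1.1, ⟨(⟨q, map_continuous q⟩ : C(B, B')).comp x.1.2.1, by
    have h0 : x.1.2.1 0 = 0 := x.1.2.2
    rw [mem_coneAlg, ContinuousMap.comp_apply, h0]
    exact map_zero q⟩), by
    rw [mem_mappingCone]
    have h1 : α x.1.1 = x.1.2.1 1 := x.2
    exact (h _).symm.trans (congrArg q h1)⟩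
  map_smul' c x := Subtype.ext (Prod.ext (map_smul p c _)
    (Subtype.ext (ContinuousMap.ext fun t => map_smul q c (x.1.2.1 t))))
  map_zero' := Subtype.ext (Prod.ext (map_zero p)
    (Subtype.ext (ContinuousMap.ext fun t => map_zero q)))
  map_add' x y := Subtype.ext (Prod.ext (map_add p _ _)
    (Subtype.ext (ContinuousMap.ext fun t => map_add q (x.1.2.1 t) (y.1.2.1 t))))
  map_mul' x y := Subtype.ext (Prod.ext (map_mul p _ _)
    (Subtype.ext (ContinuousMap.ext fun t => map_mul q (x.1.2.1 t) (y.1.2.1 t))))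
  map_star' x := Subtype.ext (Prod.ext (map_star p _)
    (Subtype.ext (ContinuousMap.ext fun t => map_star q (x.1.2.1 t))))

/-- The characteristic map of the cells of a mapping cone: a cell of `A` of dimension `k + 1`
next to the cylinder over a cell of `B` of dimension `k`. -/
def mappingConeCell {k : ℕ} {A B F G : Type*} [NonUnitalCStarAlgebra A]
    [NonUnitalCStarAlgebra B] [NonUnitalCStarAlgebra F] [NonUnitalCStarAlgebra G]
    (α : A →⋆ₙₐ[ℂ] B) (ρ : A →⋆ₙₐ[ℂ] C(UnitCube (k + 1), F))
    (τ : B →⋆ₙₐ[ℂ] C(UnitCube k, G)) :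
    MappingCone α →⋆ₙₐ[ℂ] C(UnitCube (k + 1), F × G) where
  toFun x := ⟨fun y => (ρ x.1.1 y, τ (x.1.2.1 (y 0)) (Fin.tail y)), by
    have h : Continuous fun t => τ (x.1.2.1 t) := (map_continuous τ).comp x.1.2.1.continuous
    have h' : Continuous fun y : UnitCube (k + 1) => (Fin.tail y : UnitCube k) :=
      continuous_pi fun i => continuous_apply i.succ
    have h'' : Continuous fun y : UnitCube (k + 1) => τ (x.1.2.1 (y 0)) :=
      h.comp (continuous_apply 0)
    exact (ρ x.1.1).continuous.prodMk (ContinuousEval.continuous_eval.comp (h''.prodMk h'))⟩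
  map_smul' c x := ContinuousMap.ext fun y =>
    Prod.ext (DFunLike.congr_fun (map_smul ρ c x.1.1) y)
      (DFunLike.congr_fun (map_smul τ c (x.1.2.1 (y 0))) (Fin.tail y))
  map_zero' := ContinuousMap.ext fun y =>
    Prod.ext (DFunLike.congr_fun (map_zero ρ) y) (DFunLike.congr_fun (map_zero τ) (Fin.tail y))
  map_add' x x' := ContinuousMap.ext fun y =>
    Prod.ext (DFunLike.congr_fun (map_add ρ x.1.1 x'.1.1) y)
      (DFunLike.congr_fun (map_add τ (x.1.2.1 (y 0)) (x'.1.2.1 (y 0))) (Fin.tail y))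
  map_mul' x x' := ContinuousMap.ext fun y =>
    Prod.ext (DFunLike.congr_fun (map_mul ρ x.1.1 x'.1.1) y)
      (DFunLike.congr_fun (map_mul τ (x.1.2.1 (y 0)) (x'.1.2.1 (y 0))) (Fin.tail y))
  map_star' x := ContinuousMap.ext fun y =>
    Prod.ext (DFunLike.congr_fun (map_star ρ x.1.1) y)
      (DFunLike.congr_fun (map_star τ (x.1.2.1 (y 0))) (Fin.tail y))

section

variable {k : ℕ} {A A' B B' F G : Type*} [NonUnitalCStarAlgebra A] [NonUnitalCStarAlgebra A']
  [NonUnitalCStarAlgebra B] [NonUnitalCStarAlgebra B'] [NonUnitalCStarAlgebra F]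
  [NonUnitalCStarAlgebra G] {θ : A' →⋆ₙₐ[ℂ] C(Bdry (k + 1), F)} {η : B' →⋆ₙₐ[ℂ] C(Bdry k, G)}

/-- A lifted path need not have the right endpoints, but each endpoint error lies in the kernel of
`piMap e'`, so it can be removed by a term affine in t without changing the image. -/
theorem mappingConeMap_piMap_surjective [FiniteDimensional ℂ F] [FiniteDimensional ℂ G]
    (e : A ≃⋆ₐ[ℂ] Pullback (restr (k + 1) F) θ) (e' : B ≃⋆ₐ[ℂ] Pullback (restr k G) η)
    {α : A →⋆ₙₐ[ℂ] B} {α' : A' →⋆ₙₐ[ℂ] B'} (h : ∀ a, piMap e' (α a) = α' (piMap e a)) :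
    Function.Surjective (mappingConeMap (piMap e) (piMap e') h) := fun z => by
  obtain ⟨⟨a', f', hf'⟩, hz⟩ := z
  have h0 : f' 0 = 0 := hf'
  have h1 : α' a' = f' 1 := hz
  obtain ⟨a, ha⟩ := piMap_surjective e a'
  obtain ⟨g, hg⟩ := exists_continuousMap_lift e' f'
  let f : C(unitInterval, B) :=
    ⟨fun t => g t - ((1 - t.1 : ℝ) : ℂ) • g 0 + ((t.1 : ℝ) : ℂ) • (α a - g 1), by fun_prop⟩
  have hf0 : f 0 = 0 := by simp [f]
  have hf1 : α a = f 1 := by simp [f]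
  refine ⟨⟨(a, ⟨f, hf0⟩), hf1⟩, Subtype.ext (Prod.ext ha (Subtype.ext (ContinuousMap.ext
    fun t => ?_)))⟩
  change piMap e' (g t - ((1 - t.1 : ℝ) : ℂ) • g 0 + ((t.1 : ℝ) : ℂ) • (α a - g 1)) = f' t
  rw [map_add, map_sub, map_smul, map_smul, map_sub, hg, hg, hg, h, ha, h1, h0]
  simp

/-- The mapping cone of a morphism compatible with pullback decompositions of its domain and
codomain is again a pullback. -/
theorem exists_mappingCone_equiv [FiniteDimensional ℂ F] [FiniteDimensional ℂ G]
    (e : A ≃⋆ₐ[ℂ] Pullback (restr (k + 1) F) θ) (e' : B ≃⋆ₐ[ℂ] Pullback (restr k G) η)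
    {α : A →⋆ₙₐ[ℂ] B} {α' : A' →⋆ₙₐ[ℂ] B'} (h : ∀ a, piMap e' (α a) = α' (piMap e a))
    (hα : ∀ a, piMap e a = 0 → α a = 0) :
    ∃ (ζ : MappingCone α' →⋆ₙₐ[ℂ] C(Bdry (k + 1), F × G))
      (ε : MappingCone α ≃⋆ₐ[ℂ] Pullback (restr (k + 1) (F × G)) ζ),
      piMap ε = mappingConeMap (piMap e) (piMap e') h := by
  have hker : ∀ x, mappingConeMap (piMap e) (piMap e') h x = 0 →
      piMap e x.1.1 = 0 ∧ ∀ t, piMap e' (x.1.2.1 t) = 0 := fun x hx => by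
    have hx' := congrArg Subtype.val hx
    exact ⟨congrArg Prod.fst hx',
      fun t => DFunLike.congr_fun (congrArg (fun z => (Prod.snd z).1) hx') t⟩
  refine exists_pullback_equiv _ (mappingConeCell α (rhoMap e) (rhoMap e'))
    (mappingConeMap_piMap_surjective e e' h) (fun x hx y hy => ?_) (fun x hx hx' => ?_)
    fun g hg => ?_
  · obtain ⟨ha, hb⟩ := hker x hx
    have h0 : x.1.2.1 0 = 0 := x.1.2.2
    -- By `hα` the path vanishes at 1 as well as at 0, so the two faces y₀ = 0, 1 of the cylinder
    -- carry zero.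
    have h1 : x.1.2.1 1 = 0 := (show α x.1.1 = x.1.2.1 1 from x.2).symm.trans (hα _ ha)
    refine Prod.ext ?_ ?_
    · change rhoMap e x.1.1 y = 0
      rw [rhoMap_of_mem_boundary e _ hy, ha, map_zero]
      rfl
    · change rhoMap e' (x.1.2.1 (y 0)) (Fin.tail y) = 0
      obtain ⟨i, hi⟩ := hy
      induction i using Fin.cases with
      | zero =>
        have : x.1.2.1 (y 0) = 0 := by
          rcases hi with hi | hi <;> rw [hi]
          exacts [h0, h1]
        rw [this, map_zero]
        rfl
      | succ i =>
        rw [rhoMap_of_mem_boundary e' _ (show Fin.tail y ∈ Cube.boundary (Fin k) from ⟨i, hi⟩), hb,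
          map_zero]
        rfl
  · obtain ⟨ha, hb⟩ := hker x hx
    have hx1 : ∀ y, rhoMap e x.1.1 y = 0 := fun y =>
      congrArg Prod.fst (DFunLike.congr_fun hx' y)
    have hx2 : ∀ t s, rhoMap e' (x.1.2.1 t) s = 0 := fun t s =>
      congrArg Prod.snd (DFunLike.congr_fun hx' (Fin.cons t s : UnitCube (k + 1)))
    refine Subtype.ext (Prod.ext ?_ (Subtype.ext (ContinuousMap.ext fun t => ?_)))
    · refine eq_of_rhoMap_eq_of_piMap_eq e ?_ ?_
      · exact (ContinuousMap.ext hx1).trans (map_zero (rhoMap e)).symm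
      · exact ha.trans (map_zero (piMap e)).symm
    · refine eq_of_rhoMap_eq_of_piMap_eq e' ?_ ?_
      · exact (ContinuousMap.ext (hx2 t)).trans (map_zero (rhoMap e')).symm
      · exact (hb t).trans (map_zero (piMap e')).symm
  · let gF : C(UnitCube (k + 1), F) := ContinuousMap.fst.comp g
    let gG : C(unitInterval × UnitCube k, G) :=
      ⟨fun z => (g (Fin.cons z.1 z.2)).2, by
        have : Continuous fun z : unitInterval × UnitCube k =>
            (Fin.cons z.1 z.2 : UnitCube (k + 1)) :=
          continuous_pi fun i => by
            induction i using Fin.cases with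
            | zero => exact continuous_fst
            | succ i => exact (continuous_apply i).comp continuous_snd
        exact continuous_snd.comp (g.continuous.comp this)⟩
    have hgG : ∀ t s, Fin.cons t s ∈ Cube.boundary (Fin (k + 1)) → gG (t, s) = 0 :=
      fun t s hts => congrArg Prod.snd (hg _ hts)
    -- On the kernel, `hα` makes the condition at t = 1 read f(1) = 0, so the `F` and `G` parts of
    -- `g` are realised separately, by `a` and by the path `f` below.
    let a : A := e.symm ⟨(gF, 0), by
      rw [mem_pullback, map_zero]
      exact ContinuousMap.ext fun y => congrArg Prod.fst (hg y y.2)⟩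
    let z : unitInterval → Pullback (restr k G) η := fun t => ⟨(gG.curry t, 0), by
      rw [mem_pullback, map_zero]
      refine ContinuousMap.ext fun s => hgG t s ?_
      obtain ⟨i, hi⟩ := s.2
      exact ⟨i.succ, hi⟩⟩
    have hz : Continuous z := (gG.curry.continuous.prodMk continuous_const).subtype_mk _
    have he' : Continuous e'.symm := map_continuous e'.symm
    let f : C(unitInterval, B) := ⟨fun t => e'.symm (z t), he'.comp hz⟩
    have hfπ : ∀ t, piMap e' (f t) = 0 := fun t => piMap_symm e' (z t)
    have hfρ : ∀ t s, rhoMap e' (f t) s = gG (t, s) := fun t s =>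
      DFunLike.congr_fun (rhoMap_symm e' (z t)) s
    have hf : ∀ t, t = 0 ∨ t = 1 → f t = 0 := fun t ht => by
      refine eq_of_rhoMap_eq_of_piMap_eq e' (ContinuousMap.ext fun s => ?_) ?_
      · rw [hfρ, hgG t s ⟨0, ht⟩, map_zero]
        rfl
      · rw [hfπ, map_zero]
    have ha : piMap e a = 0 := piMap_symm e _
    refine ⟨⟨(a, ⟨f, hf 0 (.inl rfl)⟩), (hα a ha).trans (hf 1 (.inr rfl)).symm⟩, ?_, ?_⟩
    · exact Subtype.ext (Prod.ext ha (Subtype.ext (ContinuousMap.ext hfπ)))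
    · refine ContinuousMap.ext fun y => Prod.ext ?_ ?_
      · exact DFunLike.congr_fun (rhoMap_symm e _) y
      · change rhoMap e' (f (y 0)) (Fin.tail y) = (g y).2
        rw [hfρ]
        exact congrArg (fun y => (g y).2) (Fin.cons_self_tail y)

/-- The kernel of `Cone(A → B) → Cone(A' → B')` is nonzero as soon as that of `A → A'` or that
of `B → B'` is. -/
theorem exists_mappingConeMap_eq_zero {α : A →⋆ₙₐ[ℂ] B} {α' : A' →⋆ₙₐ[ℂ] B'}
    {p : A →⋆ₙₐ[ℂ] A'} {q : B →⋆ₙₐ[ℂ] B'} (h : ∀ a, q (α a) = α' (p a))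
    (hα : ∀ a, p a = 0 → α a = 0)
    (hne : (∃ a, a ≠ 0 ∧ p a = 0) ∨ ∃ b, b ≠ 0 ∧ q b = 0) :
    ∃ x, x ≠ 0 ∧ mappingConeMap p q h x = 0 := by
  rcases hne with ⟨a, ha, hpa⟩ | ⟨b, hb, hqb⟩
  · refine ⟨⟨(a, 0), hα a hpa⟩, fun hx => ha (congrArg (fun z => z.1.1) hx), ?_⟩
    exact Subtype.ext (Prod.ext hpa (Subtype.ext (ContinuousMap.ext fun t => map_zero q)))
  -- A scalar bump vanishing at both ends and equal to 1/4 at t = 1/2.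
  · let f : C(unitInterval, B) :=
      ⟨fun t => ((t.1 * (1 - t.1) : ℝ) : ℂ) • b, by fun_prop⟩
    have hf0 : f 0 = 0 := by simp [f]
    have hf1 : f 1 = 0 := by simp [f]
    refine ⟨⟨(0, ⟨f, hf0⟩), (map_zero α).trans hf1.symm⟩, fun hx => hb ?_, ?_⟩
    · have := DFunLike.congr_fun (congrArg (fun z => z.1.2.1) hx) ⟨1 / 2, by norm_num, by norm_num⟩
      change (((1 / 2 * (1 - 1 / 2) : ℝ)) : ℂ) • b = 0 at this
      refine (smul_eq_zero.1 this).resolve_left ?_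
      norm_num
    · refine Subtype.ext (Prod.ext (map_zero p) (Subtype.ext (ContinuousMap.ext fun t => ?_)))
      change q (((t.1 * (1 - t.1) : ℝ) : ℂ) • b) = 0
      rw [map_smul, hqb, smul_zero]

end

/-! ### NCCW structures: padding and induction on dimension -/

namespace NCCWComplex

theorem canonicalIdeal_of_lt {n : ℕ} {A : Type u} [NonUnitalCStarAlgebra A]
    (X : NCCWComplex n A) {k : ℕ} (hk : n < k) : X.canonicalIdeal k = ⊥ := by
  cases X with
  | zero => simp only [canonicalIdeal]; rw [if_neg (by omega)]
  | succ X F θ A e => simp only [canonicalIdeal]; rw [if_neg (by omega)]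

/-- A complex of dimension `n` is a complex of every larger dimension. -/
theorem exists_of_le {n N : ℕ} (hN : n ≤ N) {A : Type u} [NonUnitalCStarAlgebra A]
    (X : NCCWComplex n A) :
    ∃ X' : NCCWComplex N A, ∀ k, X'.canonicalIdeal k = X.canonicalIdeal k := by
  induction N, hN using Nat.le_induction with
  | base => exact ⟨X, fun _ => rfl⟩
  | succ N hN ih =>
    obtain ⟨X', hX'⟩ := ih
    -- A cell with coefficients in the zero algebra is attached, which leaves `A` unchanged.
    obtain ⟨θ, e, he⟩ := exists_pullback_equiv (k := N + 1) (E := PUnit.{u + 1})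
      (NonUnitalStarAlgHom.id ℂ A) 0 Function.surjective_id (fun _ _ _ _ => rfl)
      (fun x hx _ => hx) (fun g _ => ⟨0, rfl, Subsingleton.elim _ _⟩)
    refine ⟨succ X' PUnit θ A e, fun k => ?_⟩
    rw [canonicalIdeal]
    split_ifs with hk
    · rw [← hX' k]
      ext a
      rw [TwoSidedIdeal.mem_comap, he]
      rfl
    · exact (X.canonicalIdeal_of_lt (by omega)).symm

theorem succ_canonicalIdeal_ne_bot_iff {n : ℕ} {A A' F : Type u} [NonUnitalCStarAlgebra A]
    [NonUnitalCStarAlgebra A'] (X : NCCWComplex n A') [NonUnitalCStarAlgebra F]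
    [FiniteDimensional ℂ F] (θ : A' →⋆ₙₐ[ℂ] C(Bdry (n + 1), F))
    (e : A ≃⋆ₐ[ℂ] Pullback (restr (n + 1) F) θ) :
    (succ X F θ A e).canonicalIdeal (n + 1) ≠ ⊥ ↔ ∃ a, a ≠ 0 ∧ piMap e a = 0 := by
  rw [canonicalIdeal, if_pos le_rfl, X.canonicalIdeal_of_lt (Nat.lt_succ_self n), Ne,
    eq_bot_iff]
  simp only [SetLike.le_def, TwoSidedIdeal.mem_comap, TwoSidedIdeal.mem_bot, not_forall]
  exact ⟨fun ⟨a, h, h'⟩ => ⟨a, h', h⟩, fun ⟨a, h, h'⟩ => ⟨a, h', h⟩⟩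

/-- A structure on the mapping cone of the skeleta extends over the cells of top dimension. -/
theorem exists_mappingCone_succ {n : ℕ} {A A' B B' F G : Type u} [NonUnitalCStarAlgebra A]
    [NonUnitalCStarAlgebra A'] [NonUnitalCStarAlgebra B] [NonUnitalCStarAlgebra B']
    [NonUnitalCStarAlgebra F] [NonUnitalCStarAlgebra G] [FiniteDimensional ℂ F]
    [FiniteDimensional ℂ G] {θ : A' →⋆ₙₐ[ℂ] C(Bdry (n + 1), F)} {η : B' →⋆ₙₐ[ℂ] C(Bdry n, G)}
    (e : A ≃⋆ₐ[ℂ] Pullback (restr (n + 1) F) θ) (e' : B ≃⋆ₐ[ℂ] Pullback (restr n G) η)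
    {α : A →⋆ₙₐ[ℂ] B} {α' : A' →⋆ₙₐ[ℂ] B'} (h : ∀ a, piMap e' (α a) = α' (piMap e a))
    (hα : ∀ a, piMap e a = 0 → α a = 0) (Z' : NCCWComplex n (MappingCone α')) :
    ∃ Z : NCCWComplex (n + 1) (MappingCone α),
      ((∃ a, a ≠ 0 ∧ piMap e a = 0) ∨ ∃ b, b ≠ 0 ∧ piMap e' b = 0) →
        Z.canonicalIdeal (n + 1) ≠ ⊥ := by
  obtain ⟨ζ, ε, hε⟩ := exists_mappingCone_equiv e e' h hα
  refine ⟨succ Z' (F × G) ζ _ ε, fun hne => ?_⟩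
  rw [succ_canonicalIdeal_ne_bot_iff, hε]
  exact exists_mappingConeMap_eq_zero h hα hne

/-- The mapping cone of a morphism `A → B` that preserves the canonical ideals, where the
dimension of `A` exceeds that of `B` by one. -/
theorem exists_mappingCone {N : ℕ} {A B : Type u} [NonUnitalCStarAlgebra A]
    [NonUnitalCStarAlgebra B] (X : NCCWComplex (N + 1) A) (Y : NCCWComplex N B)
    (α : A →⋆ₙₐ[ℂ] B) (hα : ∀ k, ∀ a ∈ X.canonicalIdeal k, α a ∈ Y.canonicalIdeal k) :
    ∃ Z : NCCWComplex (N + 1) (MappingCone α),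
      (X.canonicalIdeal (N + 1) ≠ ⊥ ∨ Y.canonicalIdeal N ≠ ⊥) →
        Z.canonicalIdeal (N + 1) ≠ ⊥ := by
  induction N generalizing A B with
  | zero =>
    cases X with
    | @succ _ A' _ X' F _ _ θ _ _ e =>
    have hα0 : ∀ a, piMap e a = 0 → α a = 0 := fun a ha => by
      have := hα 1 a (by
        rw [canonicalIdeal, if_pos le_rfl, TwoSidedIdeal.mem_comap, ha]
        exact zero_mem _)
      rwa [Y.canonicalIdeal_of_lt Nat.zero_lt_one, TwoSidedIdeal.mem_bot] at this
    rw [succ_canonicalIdeal_ne_bot_iff]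
    cases Y with
    | zero =>
    cases X' with
    | zero =>
    -- I^0 is a point with empty boundary, so `B` is a 0-cell attached to the zero algebra. The
    -- skeletal cone is then that of `A' → 0`, which is `A'` itself.
    obtain ⟨η, e', he'⟩ := exists_pullback_equiv (k := 0) (C' := PUnit.{u + 1})
      0 (constHom (UnitCube 0) B) (fun y => ⟨0, rfl⟩) (fun _ _ _ ⟨i, _⟩ => i.elim0)
      (fun x _ hx => DFunLike.congr_fun hx 0)
      (fun g _ => ⟨g 0, rfl, ContinuousMap.ext fun y => congrArg g (Subsingleton.elim 0 y)⟩)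
    have : FiniteDimensional ℂ (MappingCone (0 : A' →⋆ₙₐ[ℂ] PUnit.{u + 1})) := by
      let l : MappingCone (0 : A' →⋆ₙₐ[ℂ] PUnit.{u + 1}) →ₗ[ℂ] A' :=
        { toFun := fun x => x.1.1
          map_add' := fun _ _ => rfl
          map_smul' := fun _ _ => rfl }
      exact FiniteDimensional.of_injective l fun x y hxy =>
        Subtype.ext (Prod.ext hxy (Subtype.ext (ContinuousMap.ext fun t => rfl)))
    obtain ⟨Z, hZ⟩ := exists_mappingCone_succ e e' (α := α) (α' := 0) (fun _ => rfl) hα0 (zero _)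
    refine ⟨Z, fun hne => hZ (hne.imp_right fun hY => ?_)⟩
    by_contra! hB
    refine hY (eq_bot_iff.2 fun b _ => ?_)
    rw [TwoSidedIdeal.mem_bot]
    by_contra hb
    exact hB b hb (by rw [he'])
  | succ N ih =>
    cases X with
    | @succ _ A' _ X' F _ _ θ _ _ e =>
    have hα0 : ∀ a, piMap e a = 0 → α a = 0 := fun a ha => by
      have := hα (N + 2) a (by
        rw [canonicalIdeal, if_pos le_rfl, TwoSidedIdeal.mem_comap, ha]
        exact zero_mem _)
      rwa [Y.canonicalIdeal_of_lt (Nat.lt_succ_self _), TwoSidedIdeal.mem_bot] at this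
    rw [succ_canonicalIdeal_ne_bot_iff]
    cases Y with
    | @succ _ B' _ Y' G _ _ η _ _ e' =>
    rw [succ_canonicalIdeal_ne_bot_iff]
    obtain ⟨β, hβ⟩ := exists_factor (piMap e) α (piMap_surjective e) hα0
    -- Exactness of `Z'` is irrelevant: only the last layer of cells decides it. For k ≤ N+1 the
    -- ideals of `A` and `B` are preimages of those of `A'` and `B'`, so lifting `a'` to `A`
    -- transfers `hα`.
    obtain ⟨Z', -⟩ := ih X' Y' ((piMap e').comp β) fun k a' ha' => by
      rcases lt_or_ge (N + 1) k with hk | hk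
      · rw [X'.canonicalIdeal_of_lt hk, TwoSidedIdeal.mem_bot] at ha'
        rw [ha', map_zero]
        exact zero_mem _
      · obtain ⟨a, rfl⟩ := piMap_surjective e a'
        have := hα k a (by
          rw [canonicalIdeal, if_pos (by omega), TwoSidedIdeal.mem_comap]
          exact ha')
        rw [canonicalIdeal, if_pos hk, TwoSidedIdeal.mem_comap] at this
        rwa [NonUnitalStarAlgHom.comp_apply, hβ]
    exact exists_mappingCone_succ e e' (fun a => congrArg (piMap e') (hβ a).symm) hα0 Z'

end NCCWComplex
end NCCW

end

theorem mainTheorem4 {n m : ℕ} {A B : Type u} [NonUnitalCStarAlgebra A]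
    [NonUnitalCStarAlgebra B] (X : NCCW.NCCWComplex n A) (Y : NCCW.NCCWComplex m B)
    (α : A →⋆ₙₐ[ℂ] B) (hα : X.IsSimplicial Y α) :
    ∃ Z : NCCW.NCCWComplex (max n (m + 1)) (NCCW.MappingCone α),
      X.canonicalIdeal n ≠ ⊥ → Y.canonicalIdeal m ≠ ⊥ →
        Z.canonicalIdeal (max n (m + 1)) ≠ ⊥ := by
  obtain ⟨N, hN⟩ : ∃ N, max n (m + 1) = N + 1 := ⟨max n (m + 1) - 1, by omega⟩
  obtain ⟨X', hX'⟩ := X.exists_of_le (N := N + 1) (by omega)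
  obtain ⟨Y', hY'⟩ := Y.exists_of_le (N := N) (by omega)
  obtain ⟨Z, hZ⟩ := X'.exists_mappingCone Y' α fun k a ha => by
    rw [hY']
    exact hα.map_ideal k a (hX' k ▸ ha)
  rw [hN]
  refine ⟨Z, fun hn hm => hZ ?_⟩
  rw [hX', hY']
  -- Whichever of n, m+1 attains the maximum belongs to an algebra that was not padded, so its top
  -- ideal is still nonzero.
  rcases max_choice n (m + 1) with h | h
  · left
    rwa [← hN, h]
  · right
    rwa [show N = m by omega]
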